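/- Let $n\ge 3$, let $\mathbb S^{n-2}$ be the unit sphere of $\mathbb R^{n-1}$, and let $\nabla_{\mathbb S^{n-2}}$ and $\Delta_{\mathbb S^{n-2}}$ denote its gradient and its Laplace–Beltrami operator. An origin-centred ellipsoid in $\mathbb R^{n-1}$ is a set $T\bigl(\{x\in\mathbb R^{n-1} : \sum_{i=1}^{n-1} x_i^2/\lambda_i^2=1\}\bigr)$ with $\lambda_1,\dots,\lambda_{n-1}>0$ and $T\in \mathrm O(n-1)$, and the support function of a set $E$ is $h_E(u)=\sup\{x\cdot u : x\in E\}$. Let $h\in C^2(\mathbb S^{n-2})$ be a real function that vanishes nowhere on $\mathbb S^{n-2}$. Then the function $\Delta_{\mathbb S^{n-2}} h^2+2(n-1)h^2$ is differentiable on $\mathbb S^{n-2}$ with $$\nabla_{\mathbb S^{n-2}}\bigl[\Delta_{\mathbb S^{n-2}} h^2+2(n-1)h^2\bigr](u)=0\qquad\text{for every }u\in\mathbb S^{n-2}$$ if and only if $h$ or $-h$ is the restriction to $\mathbb S^{n-2}$ of the support function of an origin-centred ellipsoid in $\mathbb R^{n-1}$. -/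

import Mathlib

open scoped Manifold

/-- The extension of a function on the unit sphere to the whole space that is constant along
rays from the origin, `x ↦ f (x / ‖x‖)` for `x ≠ 0` (the value at `0` plays no role). -/
noncomputable def radialExtension {E : Type*} [NormedAddCommGroup E] [InnerProductSpace ℝ E]
    (f : Metric.sphere (0 : E) 1 → ℝ) (x : E) : ℝ :=
  open Classical in
  if hx : x ≠ 0 then
    f ⟨‖x‖⁻¹ • x, by
      rw [mem_sphere_zero_iff_norm, norm_smul, norm_inv, norm_norm]
      exact inv_mul_cancel₀ (norm_ne_zero_iff.mpr hx)⟩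
  else 0

/-- The Laplace–Beltrami operator of the unit sphere, on `C²` functions: the restriction to the
sphere of the ambient Laplacian of the extension that is constant along rays. (In polar
coordinates `Δ = ∂²/∂r² + ((m - 1)/r) ∂/∂r + r⁻² Δ_S` on `ℝᵐ`, and the radial terms vanish.) -/
noncomputable def sphericalLaplacian {E : Type*} [NormedAddCommGroup E] [InnerProductSpace ℝ E]
    [FiniteDimensional ℝ E] (f : Metric.sphere (0 : E) 1 → ℝ) (u : Metric.sphere (0 : E) 1) : ℝ :=
  Laplacian.laplacian (radialExtension f) (u : E)

/-- `f` is differentiable at the point `u` of the unit sphere, with spherical gradient `g`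
(a tangent vector at `u`, regarded as a vector of the ambient space): the ambient gradient at `u`
of the extension that is constant along rays. -/
def HasSphericalGradientAt {E : Type*} [NormedAddCommGroup E] [InnerProductSpace ℝ E]
    [CompleteSpace E] (f : Metric.sphere (0 : E) 1 → ℝ) (g : E) (u : Metric.sphere (0 : E) 1) :
    Prop :=
  HasGradientAt (radialExtension f) g (u : E)

/-- An ellipsoid in `ℝᵐ` centred at the origin: the image of a coordinate ellipsoid
`∑ xᵢ² / lᵢ² = 1` with semi-axes `lᵢ > 0` under an orthogonal transformation. -/
def IsOriginCenteredEllipsoid {m : ℕ} (S : Set (EuclideanSpace ℝ (Fin m))) : Prop :=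
  ∃ (l : Fin m → ℝ) (T : EuclideanSpace ℝ (Fin m) ≃ₗᵢ[ℝ] EuclideanSpace ℝ (Fin m)),
    (∀ i, 0 < l i) ∧ S = T '' {x | ∑ i, x i ^ 2 / l i ^ 2 = 1}

/-- The support function of a nonempty bounded set `S`, `u ↦ sup {x · u : x ∈ S}`. It is also the
support function of the convex body spanned by `S`. -/
noncomputable def supportFunction {E : Type*} [NormedAddCommGroup E] [InnerProductSpace ℝ E]
    (S : Set E) (u : E) : ℝ :=
  sSup ((fun x : E => inner ℝ x u) '' S)

/-! Write m = n - 1 and extend h² to ℝᵐ as q(x) = ‖x‖² h(x/‖x‖)², homogeneous of degree two. On the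
unit sphere Δq equals Δ_S h² + 2m h², so the gradient condition says that Δq is a constant c there
(`laplacian_norm_sq_mul`). Then f = q - k‖x‖² with k = c/(2m) is homogeneous of degree two and
harmonic off the origin.

The heart of the matter is that f is a quadratic form (`exists_bilin_of_homogeneous_harmonic`). Its
gradient is homogeneous of degree one, hence Lipschitz across the origin, so the singularity is
removable: f agrees with a smooth mollification of itself (`contDiff_of_harmonic_off_zero`). A C²
function homogeneous of degree two is half its second derivative at 0.

Thus h² is a positive definite quadratic form on the sphere. In diagonalizing coordinates its square
root |h| is the support function of an ellipsoid, and connectedness of the sphere fixes the sign of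
h. Conversely, for an ellipsoid q is a quadratic form, whose Laplacian is constant. -/

/-! ### Removable singularities of harmonic functions -/

open MeasureTheory in
/-- A smooth radial bump `ψ` of positive mass such that `y ↦ ψ y • y` is, up to a constant,
the gradient of a smooth compactly supported function `χ`. -/
theorem exists_radial_bump (E : Type*) [NormedAddCommGroup E] [InnerProductSpace ℝ E]
    [FiniteDimensional ℝ E] [Nontrivial E] [MeasurableSpace E] [BorelSpace E] :
    ∃ ψ χ : E → ℝ, ContDiff ℝ ((⊤ : ℕ∞) : WithTop ℕ∞) ψ ∧ ContDiff ℝ ((⊤ : ℕ∞) : WithTop ℕ∞) χ ∧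
      HasCompactSupport ψ ∧ HasCompactSupport χ ∧ 0 < ∫ y, ψ y ∧
      ∀ y v, fderiv ℝ χ y v = -2 * (ψ y * inner ℝ y v) := by
  -- A cutoff equal to 1 for t ≤ 1 and 0 for t ≥ 2. With χ = σ(‖y‖²) and ψ = -σ'(‖y‖²), the chain
  -- rule gives ∇χ = -2ψ(y) y.
  set σ : ℝ → ℝ := fun t => Real.smoothTransition (2 - t) with hσ
  have hσs : ContDiff ℝ ((⊤ : ℕ∞) : WithTop ℕ∞) σ :=
    Real.smoothTransition.contDiff.comp (contDiff_const.sub contDiff_id)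
  have hσ' : ContDiff ℝ ((⊤ : ℕ∞) : WithTop ℕ∞) (deriv σ) :=
    (contDiff_infty_iff_deriv.1 hσs).2
  have hσd : Differentiable ℝ σ := hσs.differentiable (by simp)
  have hσ0 : ∀ t, 2 ≤ t → σ t = 0 := fun t ht =>
    Real.smoothTransition.zero_of_nonpos (by linarith)
  have hσ'0 : ∀ t, 2 < t → deriv σ t = 0 := fun t ht => by
    have : σ =ᶠ[nhds t] fun _ => 0 := by
      filter_upwards [lt_mem_nhds ht] with s hs using hσ0 s hs.le
    rw [this.deriv_eq, deriv_const]
  have hanti : Antitone σ := fun s t hst =>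
    Real.smoothTransition.monotone (by linarith)
  have hlarge : ∀ y : E, y ∉ Metric.closedBall (0 : E) 2 → 2 < ‖y‖ ^ 2 := fun y hy => by
    rw [mem_closedBall_zero_iff, not_le] at hy
    nlinarith
  have hψs : ContDiff ℝ ((⊤ : ℕ∞) : WithTop ℕ∞) (fun y : E => -deriv σ (‖y‖ ^ 2)) :=
    (hσ'.comp (contDiff_norm_sq ℝ)).neg
  have hψc : HasCompactSupport (fun y : E => -deriv σ (‖y‖ ^ 2)) :=
    HasCompactSupport.intro (isCompact_closedBall (0 : E) 2) fun y hy => by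
      simp [hσ'0 _ (hlarge y hy)]
  refine ⟨fun y => -deriv σ (‖y‖ ^ 2), fun y => σ (‖y‖ ^ 2), hψs,
    hσs.comp (contDiff_norm_sq ℝ), hψc,
    HasCompactSupport.intro (isCompact_closedBall (0 : E) 2) fun y hy => by
      simp [hσ0 _ (hlarge y hy).le], ?_, ?_⟩
  -- As σ drops from 1 to 0 on [1, 2], σ' = -1 somewhere, so ψ ≥ 0 is not identically zero.
  · obtain ⟨t, ht, htd⟩ := exists_deriv_eq_slope σ (a := 1) (b := 2) (by norm_num)
      hσs.continuous.continuousOn hσd.differentiableOn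
    have h1 : σ 1 = 1 := Real.smoothTransition.one_of_one_le (by norm_num)
    rw [h1, hσ0 2 le_rfl] at htd
    obtain ⟨y, hy⟩ := exists_norm_eq E (Real.sqrt_nonneg t)
    refine hψs.continuous.integral_pos_of_hasCompactSupport_nonneg_nonzero hψc
      (fun y => by simpa using hanti.deriv_nonpos) (x := y) ?_
    rw [hy, Real.sq_sqrt (by linarith [ht.1]), htd]
    norm_num
  · intro y v
    have h1 : HasFDerivAt (fun y : E => ‖y‖ ^ 2) (2 • innerSL ℝ y) y :=
      (hasStrictFDerivAt_norm_sq y).hasFDerivAt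
    have h2 := (hσd (‖y‖ ^ 2)).hasDerivAt.comp_hasFDerivAt y h1
    have h3 : fderiv ℝ (fun y : E => σ (‖y‖ ^ 2)) y = _ := h2.fderiv
    rw [h3]
    simp
    ring

open MeasureTheory in
/-- A differentiable function with Lipschitz derivative that is harmonic off the origin
is smooth. -/
theorem contDiff_of_harmonic_off_zero {E : Type*} [NormedAddCommGroup E] [InnerProductSpace ℝ E]
    [FiniteDimensional ℝ E] [Nontrivial E] {ι : Type*} [Fintype ι] (b : OrthonormalBasis ι ℝ E)
    {G : E → ℝ} (hG : Differentiable ℝ G) {L : NNReal} (hL : LipschitzWith L (fderiv ℝ G))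
    (hd : ∀ x ≠ 0, DifferentiableAt ℝ (fderiv ℝ G) x)
    (hΔ : ∀ x ≠ 0, ∑ i, fderiv ℝ (fderiv ℝ G) x (b i) (b i) = 0) :
    ContDiff ℝ ((⊤ : ℕ∞) : WithTop ℕ∞) G := by
  borelize E
  obtain ⟨ψ, χ, hψs, hχs, hψc, hχc, hψpos, hχψ⟩ := exists_radial_bump E
  have hFc : Continuous (fderiv ℝ G) := hL.continuous
  have hχd : Differentiable ℝ χ := hχs.differentiable (by simp)
  have hχ1 : ContDiff ℝ 1 χ := hχs.of_le (by exact_mod_cast le_top)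
  have hcs : ∀ {f : E → ℝ}, Continuous f → Integrable (fun y => f y * ψ y) := fun hf =>
    (hf.mul hψs.continuous).integrable_of_hasCompactSupport hψc.mul_left
  -- Up to sign this is the r-derivative of the average of G(x - ry) against ψ. Since ψ(y) y is a
  -- multiple of ∇χ, integration by parts turns it into a multiple of ∫ ΔG(x - ry) χ(y) dy.
  have ibp : ∀ (x : E) (r : ℝ),
      ∫ y, fderiv ℝ G (x - r • y) y * ψ y = 0 := by
    intro x r
    have hk : ∀ i, LipschitzWith (L * ‖r‖₊) (fun y => fderiv ℝ G (x - r • y) (b i)) := by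
      intro i
      refine LipschitzWith.of_dist_le_mul fun y z => ?_
      rw [dist_eq_norm, ← sub_apply]
      refine (ContinuousLinearMap.le_opNorm _ _).trans ?_
      rw [b.norm_eq_one, mul_one]
      have := hL.dist_le_mul (x - r • y) (x - r • z)
      rw [dist_eq_norm] at this
      refine this.trans (le_of_eq ?_)
      rw [dist_sub_left, dist_smul₀]
      simp [mul_assoc]
    obtain ⟨D, hD⟩ := hχ1.lipschitzWith_of_hasCompactSupport hχc (by simp)
    have hkc : ∀ i, Continuous (fun y => fderiv ℝ G (x - r • y) (b i)) := fun i => (hk i).continuous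
    -- For r ≠ 0 the integrand vanishes except at the single point y = r⁻¹x, which is null. The
    -- Lipschitz bound on the gradient justifies the integration by parts across that point.
    have key : ∑ i, ∫ y, lineDeriv ℝ (fun y => fderiv ℝ G (x - r • y) (b i)) y (b i) * χ y = 0 := by
      rw [← integral_finsetSum]
      · by_cases hr : r = 0
        · subst hr
          simp [lineDeriv]
        · refine integral_eq_zero_of_ae ?_
          have hne : ∀ᵐ y : E, y ≠ r⁻¹ • x := by
            simp [ae_iff]
          filter_upwards [hne] with y hy
          have hy' : x - r • y ≠ 0 := by
            intro h
            apply hy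
            rw [sub_eq_zero.1 h, smul_smul, inv_mul_cancel₀ hr, one_smul]
          have : ∀ i, lineDeriv ℝ (fun y => fderiv ℝ G (x - r • y) (b i)) y (b i) =
              -r * fderiv ℝ (fderiv ℝ G) (x - r • y) (b i) (b i) := by
            intro i
            have h1 : HasFDerivAt (fun y : E => x - r • y) (-(r • ContinuousLinearMap.id ℝ E)) y := by
              simpa using ((hasFDerivAt_id y).const_smul r).const_sub x
            have h2 := ((hd _ hy').hasFDerivAt.comp y h1).clm_apply (hasFDerivAt_const (b i) y)
            refine (h2.hasLineDerivAt (b i)).lineDeriv.trans ?_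
            simp
          simp only [this, ← Finset.sum_mul, ← Finset.mul_sum, hΔ _ hy']
          simp
      · intro i _
        have h1 : Measurable (fun y => lineDeriv ℝ (fun y => fderiv ℝ G (x - r • y) (b i)) y (b i)) :=
          measurable_lineDeriv (hkc i)
        have h2 := (hχs.continuous.integrable_of_hasCompactSupport hχc (μ := volume)).bdd_mul
          (c := (L * ‖r‖₊ : NNReal) * ‖b i‖) h1.aestronglyMeasurable
          (.of_forall fun y => by
            exact norm_lineDeriv_le_of_lipschitz ℝ (hk i))
        exact h2
    simp_rw [fun i => (hk i).integral_lineDeriv_mul_eq hD hχc (μ := volume) (b i),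
      (hχd _).lineDeriv_eq_fderiv, hχψ] at key
    have e : ∀ y, fderiv ℝ G (x - r • y) y * ψ y =
        2⁻¹ * ∑ i, (-2 * (ψ y * inner ℝ y (-b i)) * fderiv ℝ G (x - r • y) (b i)) := by
      intro y
      have hy : fderiv ℝ G (x - r • y) y =
          ∑ i, inner ℝ (b i) y * fderiv ℝ G (x - r • y) (b i) := by
        have := congrArg (fderiv ℝ G (x - r • y)) (b.sum_repr' y).symm
        rw [map_sum] at this
        simpa only [map_smul, smul_eq_mul] using this
      rw [hy, Finset.sum_mul, Finset.mul_sum]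
      refine Finset.sum_congr rfl fun i _ => ?_
      rw [real_inner_comm, inner_neg_right]
      ring
    simp_rw [e]
    rw [integral_const_mul, integral_finsetSum, key, mul_zero]
    intro i _
    have : Continuous fun y => -2 * inner ℝ y (-b i) * fderiv ℝ G (x - r • y) (b i) := by
      have := hkc i
      fun_prop
    refine (hcs this).congr (.of_forall fun y => ?_)
    simp only
    ring
  have mean : ∀ x, ∫ y, G (x - y) * ψ y = G x * ∫ y, ψ y := by
    intro x
    have hder : ∀ r : ℝ, HasDerivAt (fun r : ℝ => ∫ y, G (x - r • y) * ψ y) 0 r := by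
      intro r₀
      have hcont : Continuous fun p : ℝ × E => -(fderiv ℝ G (x - p.1 • p.2) p.2 * ψ p.2) := by
        have := hψs.continuous
        fun_prop
      obtain ⟨C, hC⟩ := ((isCompact_closedBall r₀ 1).prod hψc.isCompact).exists_bound_of_continuousOn
        hcont.continuousOn
      have := (hasDerivAt_integral_of_dominated_loc_of_deriv_le (μ := (volume : Measure E))
        (F := fun r y => G (x - r • y) * ψ y)
        (F' := fun r y => -(fderiv ℝ G (x - r • y) y * ψ y)) (x₀ := r₀)
        (bound := (tsupport ψ).indicator fun _ => C)
        (Metric.closedBall_mem_nhds r₀ one_pos) (.of_forall fun r => ?_) ?_ ?_ ?_ ?_ ?_).2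
      · rwa [integral_neg, ibp, neg_zero] at this
      · have := hG.continuous
        have := hψs.continuous
        exact Continuous.aestronglyMeasurable (by fun_prop)
      · exact hcs (hG.continuous.comp (by fun_prop))
      · have := hψs.continuous
        exact Continuous.aestronglyMeasurable (by fun_prop)
      · refine .of_forall fun y r hr => ?_
        by_cases hy : y ∈ tsupport ψ
        · rw [Set.indicator_of_mem hy]
          exact hC (r, y) ⟨hr, hy⟩
        · rw [Set.indicator_of_notMem hy, image_eq_zero_of_notMem_tsupport hy]
          simp
      · refine IntegrableOn.integrable_indicator ?_ hψc.isCompact.isClosed.measurableSet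
        exact integrableOn_const hψc.isCompact.measure_lt_top.ne
      · refine .of_forall fun y r _ => ?_
        have h1 : HasDerivAt (fun r : ℝ => x - r • y) (-y) r := by
          simpa using ((hasDerivAt_id r).smul_const y).const_sub x
        have h2 := ((hG _).hasFDerivAt.comp_hasDerivAt r h1).mul_const (ψ y)
        simpa using h2
    -- The average at r = 1 is the convolution with ψ; at r = 0 it is G(x) ∫ψ.
    have h01 := is_const_of_deriv_eq_zero (fun r => (hder r).differentiableAt)
      (fun r => (hder r).deriv) 1 0
    simpa [integral_const_mul] using h01
  have hconv : G = fun x => (∫ y, ψ y)⁻¹ *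
      (convolution ψ G (ContinuousLinearMap.mul ℝ ℝ) volume) x := by
    funext x
    have : (convolution ψ G (ContinuousLinearMap.mul ℝ ℝ) volume) x = G x * ∫ y, ψ y := by
      rw [← mean x]
      simp [convolution, mul_comm]
    rw [this]
    field_simp
  rw [hconv]
  exact contDiff_const.mul (hψc.contDiff_convolution_left _ hψs hG.continuous.locallyIntegrable)

/-! ### The Laplacian in coordinates, and homogeneous functions -/

theorem laplacian_eq_sum_fderiv_fderiv {E : Type*} [NormedAddCommGroup E] [InnerProductSpace ℝ E]
    [FiniteDimensional ℝ E] {ι : Type*} [Fintype ι] (b : OrthonormalBasis ι ℝ E) (f : E → ℝ)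
    (x : E) :
    Laplacian.laplacian f x = ∑ i, fderiv ℝ (fderiv ℝ f) x (b i) (b i) := by
  rw [InnerProductSpace.laplacian_eq_iteratedFDeriv_orthonormalBasis f b]
  simp [iteratedFDeriv_two_apply]

section Homogeneous

variable {E V : Type*} [NormedAddCommGroup E] [NormedSpace ℝ E]
  [NormedAddCommGroup V] [NormedSpace ℝ V]

/-- The target is a general V so that the lemma applies again to `fderiv ℝ f`. Differentiability is
not assumed, so it may be used at the origin. -/
theorem fderiv_smul_of_homogeneous {f : E → V} {k : ℕ}
    (hf : ∀ t : ℝ, 0 < t → ∀ x, f (t • x) = t ^ (k + 1) • f x) {t : ℝ} (ht : 0 < t) (x : E) :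
    fderiv ℝ f (t • x) = t ^ k • fderiv ℝ f x := by
  have h1 : fderiv ℝ (fun x => f (t • x)) x = t • fderiv ℝ f (t • x) := fderiv_comp_smul ..
  have h2 : fderiv ℝ (fun x => f (t • x)) x = t ^ (k + 1) • fderiv ℝ f x := by
    rw [funext (hf t ht)]
    exact congrFun (fderiv_const_smul_field (𝕜 := ℝ) (t ^ (k + 1)) (f := f)) x
  rw [h1, pow_succ', mul_smul] at h2
  exact smul_right_injective _ ht.ne' h2

theorem exists_bound_of_homogeneous [FiniteDimensional ℝ E] {f : E → V} (k : ℕ)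
    (hf : ∀ t : ℝ, 0 < t → ∀ x, f (t • x) = t ^ k • f x)
    (hc : ContinuousOn f {0}ᶜ) :
    ∃ C : ℝ, 0 ≤ C ∧ ∀ x ≠ 0, ‖f x‖ ≤ C * ‖x‖ ^ k := by
  obtain ⟨C, hC⟩ := (isCompact_sphere (0 : E) 1).exists_bound_of_continuousOn
    (hc.mono fun x hx => by
      rintro rfl
      simp at hx)
  refine ⟨|C|, abs_nonneg C, fun x hx => ?_⟩
  have hx' : 0 < ‖x‖ := norm_pos_iff.2 hx
  have h1 := hf ‖x‖ hx' (‖x‖⁻¹ • x)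
  rw [smul_smul, mul_inv_cancel₀ hx'.ne', one_smul] at h1
  rw [h1, norm_smul, norm_pow, norm_norm, mul_comm]
  gcongr
  exact (hC _ (by simp [norm_smul, hx'.ne'])).trans (le_abs_self C)

/-- The derivative has degree 0, hence is bounded off the origin, and the mean value inequality
handles segments avoiding 0. On a segment through 0 linear growth suffices, because ‖x‖ + ‖y‖ = ‖x -
y‖. -/
theorem lipschitzWith_of_homogeneous [FiniteDimensional ℝ E] {f : E → V}
    (hf : ∀ t : ℝ, 0 < t → ∀ x, f (t • x) = t • f x) (h0 : f 0 = 0)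
    (hd : ∀ x ≠ 0, ContDiffAt ℝ 1 f x) :
    ∃ L : NNReal, LipschitzWith L f := by
  obtain ⟨C, hC, hfC⟩ := exists_bound_of_homogeneous 1 (by simpa using hf)
    (fun x hx => (hd x hx).continuousAt.continuousWithinAt)
  obtain ⟨D, hD, hfD⟩ := exists_bound_of_homogeneous (f := fderiv ℝ f) 0
    (fun t ht x => fderiv_smul_of_homogeneous (k := 0) (by simpa using hf) ht x)
    (fun x hx => ((hd x hx).fderiv_right (m := 0) (by norm_num)).continuousAt.continuousWithinAt)
  have hfC' : ∀ x, ‖f x‖ ≤ C * ‖x‖ := fun x => by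
    rcases eq_or_ne x 0 with rfl | hx
    · simp [h0]
    · simpa using hfC x hx
  refine ⟨⟨max C D, le_max_of_le_left hC⟩, LipschitzWith.of_dist_le_mul fun x y => ?_⟩
  rw [dist_eq_norm, dist_eq_norm]
  change _ ≤ max C D * _
  by_cases h : (0 : E) ∈ segment ℝ x y
  · have hxy := dist_add_dist_of_mem_segment h
    rw [dist_zero_right, dist_zero_left, dist_eq_norm] at hxy
    calc ‖f x - f y‖ ≤ ‖f x‖ + ‖f y‖ := norm_sub_le _ _
      _ ≤ C * ‖x‖ + C * ‖y‖ := add_le_add (hfC' x) (hfC' y)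
      _ = C * ‖x - y‖ := by rw [← hxy]; ring
      _ ≤ _ := by gcongr; exact le_max_left _ _
  · have hne : ∀ z ∈ segment ℝ x y, z ≠ 0 := fun z hz h0 => h (h0 ▸ hz)
    refine ((convex_segment x y).norm_image_sub_le_of_norm_fderiv_le
      (fun z hz => (hd z (hne z hz)).differentiableAt (by norm_num))
      (fun z hz => by simpa using hfD z (hne z hz))
      (right_mem_segment ℝ x y) (left_mem_segment ℝ x y)).trans ?_
    gcongr
    exact le_max_right _ _

/-- A function that is homogeneous of degree two and twice differentiable at the origin is a
quadratic form. -/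
theorem eq_bilin_of_homogeneous_of_contDiff {f : E → ℝ}
    (hf : ∀ t : ℝ, 0 < t → ∀ x, f (t • x) = t ^ 2 * f x) (hd : ContDiff ℝ 2 f) (x : E) :
    f x = 2⁻¹ * fderiv ℝ (fderiv ℝ f) 0 x x := by
  have hF : ∀ t : ℝ, 0 < t → ∀ x, fderiv ℝ f (t • x) = t • fderiv ℝ f x := fun t ht x => by
    simpa using fderiv_smul_of_homogeneous (k := 1) hf ht x
  have hFd : Differentiable ℝ (fderiv ℝ f) :=
    (hd.fderiv_right (m := 1) (by norm_num)).differentiable (by norm_num)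
  have hF0 : fderiv ℝ f 0 = 0 := by
    have h2 := hF 2 two_pos 0
    rw [smul_zero, two_smul] at h2
    simpa using h2
  -- Differentiate Df(tx) = t Df(x) at t = 0. Homogeneity covers only t > 0, hence the one-sided
  -- derivatives on `Set.Ici 0`.
  have hlin : fderiv ℝ f x = fderiv ℝ (fderiv ℝ f) 0 x := by
    have h1 : HasDerivAt (fun t : ℝ => t • x) x 0 := by
      simpa using (hasDerivAt_id (0 : ℝ)).smul_const x
    have h2 : HasDerivAt (fun t : ℝ => fderiv ℝ f (t • x)) (fderiv ℝ (fderiv ℝ f) 0 x) 0 := by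
      have h0 : HasFDerivAt (fderiv ℝ f) (fderiv ℝ (fderiv ℝ f) 0) ((0 : ℝ) • x) := by
        rw [zero_smul]
        exact (hFd 0).hasFDerivAt
      exact h0.comp_hasDerivAt 0 h1
    have h3 : HasDerivAt (fun t : ℝ => t • fderiv ℝ f x) (fderiv ℝ f x) 0 := by
      simpa using (hasDerivAt_id (0 : ℝ)).smul_const (fderiv ℝ f x)
    have h4 : HasDerivWithinAt (fun t : ℝ => t • fderiv ℝ f x)
        (fderiv ℝ (fderiv ℝ f) 0 x) (Set.Ici 0) 0 := by
      refine h2.hasDerivWithinAt.congr (fun t ht => ?_) (by simp [hF0])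
      rcases eq_or_lt_of_le (Set.mem_Ici.1 ht) with rfl | ht
      · simp [hF0]
      · exact (hF t ht x).symm
    exact (uniqueDiffOn_Ici (0 : ℝ) 0 Set.self_mem_Ici).eq_deriv _ h3.hasDerivWithinAt h4
  rw [← hlin]
  -- Euler's identity Df(x)x = 2f(x), from differentiating at t = 1.
  have h1 : HasDerivAt (fun t : ℝ => f (t • x)) (fderiv ℝ f x x) 1 := by
    have h1 : HasDerivAt (fun t : ℝ => t • x) x 1 := by
      simpa using (hasDerivAt_id (1 : ℝ)).smul_const x
    have h0 : HasFDerivAt f (fderiv ℝ f x) ((1 : ℝ) • x) := by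
      rw [one_smul]
      exact ((hd.differentiable (by norm_num)) x).hasFDerivAt
    exact h0.comp_hasDerivAt 1 h1
  have h2 : HasDerivAt (fun t : ℝ => t ^ 2 * f x) (2 * f x) 1 := by
    simpa using (hasDerivAt_pow 2 (1 : ℝ)).mul_const (f x)
  have h3 : HasDerivAt (fun t : ℝ => t ^ 2 * f x) (fderiv ℝ f x x) 1 := by
    refine h1.congr_of_eventuallyEq ?_
    filter_upwards [lt_mem_nhds (zero_lt_one' ℝ)] with t ht
    exact (hf t ht x).symm
  rw [h3.unique h2]
  ring

end Homogeneous

/-- A function that is homogeneous of degree two, and harmonic off the origin, is a quadratic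
form. -/
theorem exists_bilin_of_homogeneous_harmonic {E : Type*} [NormedAddCommGroup E]
    [InnerProductSpace ℝ E] [FiniteDimensional ℝ E] [Nontrivial E] {f : E → ℝ}
    (hf : ∀ t : ℝ, 0 < t → ∀ x, f (t • x) = t ^ 2 * f x)
    (hd : ∀ x ≠ 0, ContDiffAt ℝ 2 f x)
    (hΔ : ∀ x, ‖x‖ = 1 → Laplacian.laplacian f x = 0) :
    ∃ B : E →L[ℝ] E →L[ℝ] ℝ, ∀ x, f x = B x x := by
  have hF : ∀ t : ℝ, 0 < t → ∀ x, fderiv ℝ f (t • x) = t • fderiv ℝ f x := fun t ht x => by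
    simpa using fderiv_smul_of_homogeneous (k := 1) hf ht x
  have hF0 : fderiv ℝ f 0 = 0 := by
    have h2 := hF 2 two_pos 0
    rw [smul_zero, two_smul] at h2
    simpa using h2
  have hFd : ∀ x ≠ 0, ContDiffAt ℝ 1 (fderiv ℝ f) x := fun x hx =>
    (hd x hx).fderiv_right (by norm_num)
  obtain ⟨L, hL⟩ := lipschitzWith_of_homogeneous hF hF0 hFd
  have hf0 : f 0 = 0 := by
    have h2 := hf 2 two_pos 0
    rw [smul_zero] at h2
    linarith
  -- At the origin the bound |f(x)| ≤ C‖x‖² forces derivative 0.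
  have hfd : Differentiable ℝ f := by
    intro x
    rcases eq_or_ne x 0 with rfl | hx
    · obtain ⟨C, -, hC⟩ := exists_bound_of_homogeneous 2 hf
        (fun x hx => (hd x hx).continuousAt.continuousWithinAt)
      refine HasFDerivAt.differentiableAt (f' := 0) ?_
      rw [hasFDerivAt_iff_isLittleO_nhds_zero]
      have h1 : (fun x : E => f x) =O[nhds 0] fun x => ‖x‖ ^ 2 := by
        refine Asymptotics.IsBigO.of_bound C (.of_forall fun x => ?_)
        rcases eq_or_ne x 0 with rfl | hx
        · simp [hf0]
        · simpa using hC x hx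
      simpa [hf0] using h1.trans_isLittleO (Asymptotics.isLittleO_norm_pow_id one_lt_two)
    · exact (hd x hx).differentiableAt (by norm_num)
  have hsmooth := contDiff_of_harmonic_off_zero (stdOrthonormalBasis ℝ E) hfd hL
    (fun x hx => (hFd x hx).differentiableAt (by norm_num)) fun x hx => by
      have hx' : 0 < ‖x‖ := norm_pos_iff.2 hx
      have h1 := hΔ (‖x‖⁻¹ • x) (by simp [norm_smul, hx'.ne'])
      -- The second derivative has degree 0, so vanishing of its trace on the sphere spreads to all
      -- x ≠ 0.
      rw [laplacian_eq_sum_fderiv_fderiv (stdOrthonormalBasis ℝ E),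
        fderiv_smul_of_homogeneous (k := 0) (by simpa using hF) (inv_pos.2 hx')] at h1
      simpa using h1
  refine ⟨(2⁻¹ : ℝ) • fderiv ℝ (fderiv ℝ f) 0, fun x => ?_⟩
  simpa using eq_bilin_of_homogeneous_of_contDiff hf
    (contDiff_infty.1 hsmooth 2) x

/-! ### Calculus of the radial extension -/

section RadialExtension

variable {E : Type*} [NormedAddCommGroup E] [InnerProductSpace ℝ E]

theorem radialExtension_coe (f : Metric.sphere (0 : E) 1 → ℝ) (u : Metric.sphere (0 : E) 1) :
    radialExtension f u = f u := by
  have hu : (u : E) ≠ 0 := ne_zero_of_mem_unit_sphere u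
  rw [radialExtension, dif_pos hu]
  congr
  simp

theorem radialExtension_smul (f : Metric.sphere (0 : E) 1 → ℝ) {t : ℝ} (ht : 0 < t) (x : E) :
    radialExtension f (t • x) = radialExtension f x := by
  rcases eq_or_ne x 0 with rfl | hx
  · rw [smul_zero]
  · rw [radialExtension, radialExtension, dif_pos hx, dif_pos (smul_ne_zero ht.ne' hx)]
    congr 2
    rw [norm_smul, Real.norm_of_nonneg ht.le, smul_smul, mul_inv, mul_right_comm,
      inv_mul_cancel₀ ht.ne', one_mul]

theorem contDiffAt_radialExtension {d : ℕ} [Fact (Module.finrank ℝ E = d + 1)]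
    {n : WithTop ℕ∞} {f : Metric.sphere (0 : E) 1 → ℝ} (hf : ContMDiff (𝓡 d) 𝓘(ℝ, ℝ) n f)
    {x : E} (hx : x ≠ 0) : ContDiffAt ℝ n (radialExtension f) x := by
  let U : TopologicalSpace.Opens E := ⟨{0}ᶜ, isOpen_compl_singleton⟩
  have h1 : ContMDiff 𝓘(ℝ, E) 𝓘(ℝ, E) n (fun y : U => ‖(y : E)‖⁻¹ • (y : E)) := by
    intro y
    have hy : (y : E) ≠ 0 := y.2
    refine contMDiffAt_subtype_iff (f := fun y : E => ‖y‖⁻¹ • y).2 (ContDiffAt.contMDiffAt ?_)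
    exact ((contDiffAt_norm ℝ hy).inv (norm_ne_zero_iff.2 hy)).smul contDiffAt_id
  have h2 : ∀ y : U, ‖(y : E)‖⁻¹ • (y : E) ∈ Metric.sphere (0 : E) 1 := fun y => by
    have hy : (y : E) ≠ 0 := y.2
    simp [norm_smul, hy]
  have h3 := hf.comp (h1.codRestrict_sphere (n := d) h2)
  rw [← contMDiffAt_iff_contDiffAt]
  refine (contMDiffAt_subtype_iff (U := U) (x := ⟨x, hx⟩)).1 ?_
  refine (h3 ⟨x, hx⟩).congr_of_eventuallyEq (.of_forall fun y => ?_)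
  have hy : (y : E) ≠ 0 := y.2
  simp only [radialExtension, dif_pos hy]
  rfl

/-- By scale invariance the gradient of the extension vanishes on all of E \ {0}, which is connected
in dimension at least two. -/
theorem eq_of_hasSphericalGradientAt_zero [CompleteSpace E] (hE : 1 < Module.rank ℝ E)
    {f : Metric.sphere (0 : E) 1 → ℝ} (hf : ∀ u, HasSphericalGradientAt f 0 u)
    (u v : Metric.sphere (0 : E) 1) : f u = f v := by
  have h1 : ∀ x : E, x ≠ 0 → HasFDerivAt (radialExtension f) (0 : E →L[ℝ] ℝ) x := by
    intro x hx
    have hx' : 0 < ‖x‖⁻¹ := inv_pos.2 (norm_pos_iff.2 hx)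
    have h2 : HasFDerivAt (radialExtension f) (0 : E →L[ℝ] ℝ) (‖x‖⁻¹ • x) := by
      have h3 := (hf ⟨‖x‖⁻¹ • x, by simp [norm_smul, hx]⟩).hasFDerivAt
      rwa [map_zero] at h3
    have h3 := h2.comp x ((hasFDerivAt_id x).const_smul ‖x‖⁻¹)
    rw [ContinuousLinearMap.zero_comp] at h3
    exact h3.congr_of_eventuallyEq
      (.of_forall fun y => (radialExtension_smul f hx' y).symm)
  rw [← radialExtension_coe f u, ← radialExtension_coe f v]
  exact isOpen_compl_singleton.is_const_of_fderiv_eq_zero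
    (isConnected_compl_singleton_of_one_lt_rank hE 0).isPreconnected
    (fun x hx => (h1 x hx).differentiableAt.differentiableWithinAt)
    (fun x hx => (h1 x hx).fderiv) (ne_zero_of_mem_unit_sphere u) (ne_zero_of_mem_unit_sphere v)

theorem hasSphericalGradientAt_const [CompleteSpace E] (c : ℝ) (u : Metric.sphere (0 : E) 1) :
    HasSphericalGradientAt (fun _ => c) 0 u := by
  have h : radialExtension (fun _ : Metric.sphere (0 : E) 1 => c) =ᶠ[nhds (u : E)] fun _ => c := by
    filter_upwards [isOpen_ne.mem_nhds (ne_zero_of_mem_unit_sphere u)] with x hx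
    exact dif_pos hx
  exact (hasGradientAt_const (u : E) c).congr_of_eventuallyEq h

variable [FiniteDimensional ℝ E]

/-- Leibniz rule with Δ‖x‖² = 2 dim E; the cross term 4⟨u, ∇f(u)⟩ vanishes because f is constant
along rays. -/
theorem laplacian_norm_sq_mul {f : E → ℝ} (hf : ∀ t : ℝ, 0 < t → ∀ x, f (t • x) = f x) {u : E}
    (hu : ‖u‖ = 1) (hd : ContDiffAt ℝ 2 f u) :
    Laplacian.laplacian (fun x => ‖x‖ ^ 2 * f x) u =
      Laplacian.laplacian f u + 2 * Module.finrank ℝ E * f u := by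
  have hN : ∀ x : E, HasFDerivAt (fun y : E => ‖y‖ ^ 2) ((2 : ℝ) • innerSL ℝ x) x := fun x => by
    simpa [two_smul] using (hasStrictFDerivAt_norm_sq x).hasFDerivAt
  have hev : fderiv ℝ (fun x => ‖x‖ ^ 2 * f x) =ᶠ[nhds u]
      fun y => ‖y‖ ^ 2 • fderiv ℝ f y + f y • ((2 : ℝ) • innerSL ℝ y) := by
    filter_upwards [hd.eventually (by simp)] with y hy
    exact ((hN y).mul (hy.differentiableAt (by norm_num)).hasFDerivAt).fderiv
  have hFd : HasFDerivAt (fderiv ℝ f) (fderiv ℝ (fderiv ℝ f) u) u :=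
    ((hd.fderiv_right (m := 1) (by norm_num)).differentiableAt (by norm_num)).hasFDerivAt
  have hfd : HasFDerivAt f (fderiv ℝ f u) u := (hd.differentiableAt (by norm_num)).hasFDerivAt
  -- `innerSL ℝ` is typed as conjugate-linear in its first argument; I is the same map typed as
  -- linear.
  obtain ⟨I, hI⟩ : ∃ I : E →L[ℝ] E →L[ℝ] ℝ, ∀ x, I x = innerSL ℝ x := ⟨innerSL ℝ, fun _ => rfl⟩
  simp only [← hI] at hN hev
  have hDD := ((hN u).smul hFd).add (hfd.smul ((2 : ℝ) • I).hasFDerivAt)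
  have hray : fderiv ℝ f u u = 0 := by
    have h1 : HasDerivAt (fun t : ℝ => t • u) u 1 := by
      simpa using (hasDerivAt_id (1 : ℝ)).smul_const u
    have h0 : HasFDerivAt f (fderiv ℝ f u) ((1 : ℝ) • u) := by rwa [one_smul]
    have h2 : HasDerivAt (fun t : ℝ => f (t • u)) (fderiv ℝ f u u) 1 := h0.comp_hasDerivAt 1 h1
    refine h2.unique ((hasDerivAt_const (1 : ℝ) (f u)).congr_of_eventuallyEq ?_)
    filter_upwards [lt_mem_nhds (zero_lt_one' ℝ)] with t ht using hf t ht u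
  set b := stdOrthonormalBasis ℝ E
  have hsum : ∑ i, inner ℝ u (b i) * fderiv ℝ f u (b i) = 0 := by
    have := congrArg (fderiv ℝ f u) (b.sum_repr' u)
    rw [map_sum, hray] at this
    simpa only [map_smul, smul_eq_mul, real_inner_comm] using this
  rw [laplacian_eq_sum_fderiv_fderiv b, laplacian_eq_sum_fderiv_fderiv b, hev.fderiv_eq]
  have hterm : ∀ i, fderiv ℝ (fun y => ‖y‖ ^ 2 • fderiv ℝ f y + f y • ((2 : ℝ) • I y)) u
      (b i) (b i) = fderiv ℝ (fderiv ℝ f) u (b i) (b i) +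
        4 * (inner ℝ u (b i) * fderiv ℝ f u (b i)) + 2 * f u := by
    intro i
    rw [show fderiv ℝ (fun y => ‖y‖ ^ 2 • fderiv ℝ f y + f y • ((2 : ℝ) • I y)) u = _ from
      hDD.fderiv]
    simp [hu, hI]
    ring
  rw [Finset.sum_congr rfl fun i _ => hterm i, Finset.sum_add_distrib, Finset.sum_add_distrib,
    ← Finset.mul_sum, hsum]
  simp
  ring

theorem laplacian_bilin_const (B : E →L[ℝ] E →L[ℝ] ℝ) (x y : E) :
    Laplacian.laplacian (fun x => B x x) x = Laplacian.laplacian (fun x => B x x) y := by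
  have h1 : fderiv ℝ (fun x => B x x) = fun x => (B + B.flip) x := by
    funext x
    refine (B.hasFDerivAt.clm_apply (hasFDerivAt_id x)).fderiv.trans ?_
    ext y
    simp
  rw [laplacian_eq_sum_fderiv_fderiv (stdOrthonormalBasis ℝ E),
    laplacian_eq_sum_fderiv_fderiv (stdOrthonormalBasis ℝ E), h1]
  simp only [ContinuousLinearMap.fderiv]

end RadialExtension

/-! ### Quadratic forms and support functions of ellipsoids -/

theorem exists_bilin_add_norm_sq {E : Type*} [NormedAddCommGroup E] [InnerProductSpace ℝ E]
    (B : E →L[ℝ] E →L[ℝ] ℝ) (k : ℝ) :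
    ∃ B' : E →L[ℝ] E →L[ℝ] ℝ, ∀ x, B' x x = B x x + k * ‖x‖ ^ 2 :=
  have ⟨I, hI⟩ : ∃ I : E →L[ℝ] E →L[ℝ] ℝ, ∀ x, I x = innerSL ℝ x := ⟨innerSL ℝ, fun _ => rfl⟩
  ⟨B + k • I, fun x => by simp [hI]⟩

theorem exists_bilin_sum_sq {E : Type*} [NormedAddCommGroup E] [NormedSpace ℝ E] {ι : Type*}
    [Fintype ι] (L : ι → E →L[ℝ] ℝ) (a : ι → ℝ) :
    ∃ B : E →L[ℝ] E →L[ℝ] ℝ, ∀ x, B x x = ∑ i, a i * L i x ^ 2 :=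
  ⟨∑ i, a i • (L i).smulRight (L i), fun x => by simp [sq]⟩


/-- The support function of an ellipsoid is the square root of a quadratic form. -/
theorem supportFunction_ellipsoid {m : ℕ} {l : Fin m → ℝ} (hl : ∀ i, 0 < l i)
    (T : EuclideanSpace ℝ (Fin m) ≃ₗᵢ[ℝ] EuclideanSpace ℝ (Fin m))
    {u : EuclideanSpace ℝ (Fin m)} (hu : u ≠ 0) :
    supportFunction (T '' {x | ∑ i, x i ^ 2 / l i ^ 2 = 1}) u =
      √(∑ i, l i ^ 2 * T.symm u i ^ 2) := by
  set w := T.symm u with hw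
  have hinner : ∀ x, inner ℝ (T x) u = ∑ i, x i * w i := fun x => by
    have : u = T w := by simp [hw]
    rw [this, T.inner_map_map, PiLp.inner_apply]
    simp [mul_comm]
  have hw0 : w ≠ 0 := by simpa [hw] using hu
  obtain ⟨j, hj⟩ : ∃ j, w j ≠ 0 := by
    by_contra! h
    exact hw0 (by ext i; simp [h i])
  have hpos : 0 < ∑ i, l i ^ 2 * w i ^ 2 :=
    Finset.sum_pos' (fun i _ => by positivity)
      ⟨j, Finset.mem_univ j, mul_pos (pow_pos (hl j) 2) (by positivity)⟩
  set s := √(∑ i, l i ^ 2 * w i ^ 2) with hs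
  have hspos : 0 < s := Real.sqrt_pos.2 hpos
  have hs2 : s ^ 2 = ∑ i, l i ^ 2 * w i ^ 2 := Real.sq_sqrt hpos.le
  refine IsGreatest.csSup_eq ⟨?_, ?_⟩
  -- The maximizer is the equality case of Cauchy–Schwarz: xᵢ/lᵢ proportional to lᵢwᵢ, normalized by
  -- s.
  · refine ⟨T (WithLp.toLp 2 fun i => l i ^ 2 * w i / s), ⟨_, ?_, rfl⟩, ?_⟩
    · have : ∀ i, (l i ^ 2 * w i / s) ^ 2 / l i ^ 2 = l i ^ 2 * w i ^ 2 / s ^ 2 := fun i => by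
        have := (hl i).ne'
        field_simp
      simp only [Set.mem_ofPred_eq, this]
      rw [← Finset.sum_div, ← hs2, div_self (by positivity)]
    · simp only [hinner]
      have : ∀ i, l i ^ 2 * w i / s * w i = l i ^ 2 * w i ^ 2 / s := fun i => by ring
      simp only [this]
      rw [← Finset.sum_div, ← hs2]
      field_simp
  · rintro _ ⟨_, ⟨x, hx, rfl⟩, rfl⟩
    simp only [hinner]
    -- Cauchy–Schwarz for xᵢ/lᵢ and lᵢwᵢ, whose products are xᵢwᵢ.
    have h1 := Finset.sum_mul_sq_le_sq_mul_sq Finset.univ (fun i => x i / l i) fun i => l i * w i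
    simp only [div_pow, mul_pow] at h1
    rw [Set.mem_ofPred_eq] at hx
    rw [hx, one_mul] at h1
    have h2 : ∀ i, x i / l i * (l i * w i) = x i * w i := fun i => by
      have := (hl i).ne'
      field_simp
    simp only [h2] at h1
    exact Real.le_sqrt_of_sq_le h1

/-- Every quadratic form is represented by a symmetric operator. -/
theorem exists_isSymmetric_inner_eq_bilin {E : Type*} [NormedAddCommGroup E]
    [InnerProductSpace ℝ E] [CompleteSpace E] (B : E →L[ℝ] E →L[ℝ] ℝ) :
    ∃ A : E →ₗ[ℝ] E, A.IsSymmetric ∧ ∀ x, inner ℝ (A x) x = B x x := by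
  set B' : E →L[ℝ] E →L[ℝ] ℝ := (2⁻¹ : ℝ) • (B + B.flip)
  have hA : ∀ x y, inner ℝ (InnerProductSpace.continuousLinearMapOfBilin B' x) y = B' x y :=
    InnerProductSpace.continuousLinearMapOfBilin_apply B'
  refine ⟨InnerProductSpace.continuousLinearMapOfBilin B', fun x y => ?_, fun x => ?_⟩
  · have h1 : B' x y = B' y x := by simp [B', add_comm]
    exact (hA x y).trans (h1.trans ((hA y x).symm.trans (real_inner_comm _ _)))
  · refine (hA x x).trans ?_
    simp [B']
    ring

/-- A positive definite quadratic form is a sum of squares in suitable orthonormal coordinates. -/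
theorem exists_diagonalization_of_pos {m : ℕ}
    (B : EuclideanSpace ℝ (Fin m) →L[ℝ] EuclideanSpace ℝ (Fin m) →L[ℝ] ℝ)
    (hpos : ∀ x, ‖x‖ = 1 → 0 < B x x) :
    ∃ (l : Fin m → ℝ) (T : EuclideanSpace ℝ (Fin m) ≃ₗᵢ[ℝ] EuclideanSpace ℝ (Fin m)),
      (∀ i, 0 < l i) ∧ ∀ x, B x x = ∑ i, l i ^ 2 * T.symm x i ^ 2 := by
  obtain ⟨A, hsymm, hA⟩ := exists_isSymmetric_inner_eq_bilin B
  have hfin : Module.finrank ℝ (EuclideanSpace ℝ (Fin m)) = m := by simp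
  set b := hsymm.eigenvectorBasis hfin
  have hdiag : ∀ x, B x x = ∑ i, hsymm.eigenvalues hfin i * b.repr x i ^ 2 := fun x => by
    rw [← hA, ← b.repr.inner_map_map, PiLp.inner_apply]
    refine Finset.sum_congr rfl fun i _ => ?_
    rw [hsymm.eigenvectorBasis_apply_self_apply hfin x i]
    simp
    ring
  have hev : ∀ i, 0 < hsymm.eigenvalues hfin i := fun i => by
    have h1 := hpos (b i) (b.norm_eq_one i)
    rwa [hdiag, Finset.sum_eq_single i (fun j _ hj => by simp [hj]) (by simp),
      b.repr_self, PiLp.single_apply, if_pos rfl, one_pow, mul_one] at h1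
  refine ⟨fun i => √(hsymm.eigenvalues hfin i), b.repr.symm, fun i => Real.sqrt_pos.2 (hev i),
    fun x => ?_⟩
  rw [hdiag]
  refine Finset.sum_congr rfl fun i _ => ?_
  rw [Real.sq_sqrt (hev i).le]
  rfl

/-! ### From the differential condition to quadratic forms and back -/

theorem contDiffAt_radialExtension_euclidean {d : ℕ} {n : WithTop ℕ∞}
    {f : Metric.sphere (0 : EuclideanSpace ℝ (Fin (d + 1))) 1 → ℝ}
    (hf : ContMDiff (𝓡 d) 𝓘(ℝ, ℝ) n f) {x : EuclideanSpace ℝ (Fin (d + 1))} (hx : x ≠ 0) :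
    ContDiffAt ℝ n (radialExtension f) x :=
  haveI := Fact.mk (@finrank_euclideanSpace_fin ℝ _ (d + 1))
  contDiffAt_radialExtension hf hx

theorem sphericalLaplacian_sq_add_eq {d : ℕ}
    {h : Metric.sphere (0 : EuclideanSpace ℝ (Fin (d + 1))) 1 → ℝ}
    (hC2 : ContMDiff (𝓡 d) 𝓘(ℝ, ℝ) 2 h)
    (v : Metric.sphere (0 : EuclideanSpace ℝ (Fin (d + 1))) 1) :
    sphericalLaplacian (fun w => h w ^ 2) v + 2 * ((d : ℝ) + 1) * h v ^ 2 =
      Laplacian.laplacian (fun x => ‖x‖ ^ 2 * radialExtension (fun w => h w ^ 2) x) v := by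
  have hg : ContMDiff (𝓡 d) 𝓘(ℝ, ℝ) 2 (fun w => h w ^ 2) := hC2.pow 2
  rw [laplacian_norm_sq_mul (fun t ht x => radialExtension_smul _ ht x) (by simp)
    (contDiffAt_radialExtension_euclidean hg (ne_zero_of_mem_unit_sphere v)), radialExtension_coe,
    sphericalLaplacian]
  simp

theorem exists_bilin_of_sphericalGradient_eq_zero {d : ℕ} (hd : 1 ≤ d)
    {h : Metric.sphere (0 : EuclideanSpace ℝ (Fin (d + 1))) 1 → ℝ}
    (hC2 : ContMDiff (𝓡 d) 𝓘(ℝ, ℝ) 2 h)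
    (hgrad : ∀ u, HasSphericalGradientAt
        (fun v => sphericalLaplacian (fun w => h w ^ 2) v + 2 * ((d : ℝ) + 1) * h v ^ 2) 0 u) :
    ∃ B : EuclideanSpace ℝ (Fin (d + 1)) →L[ℝ] EuclideanSpace ℝ (Fin (d + 1)) →L[ℝ] ℝ,
      ∀ u : Metric.sphere (0 : EuclideanSpace ℝ (Fin (d + 1))) 1, h u ^ 2 = B u u := by
  have hrank : 1 < Module.rank ℝ (EuclideanSpace ℝ (Fin (d + 1))) := by
    rw [← Module.finrank_eq_rank, finrank_euclideanSpace_fin]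
    exact_mod_cast (by omega : 1 < d + 1)
  set g : Metric.sphere (0 : EuclideanSpace ℝ (Fin (d + 1))) 1 → ℝ := fun w => h w ^ 2
  have hg : ContMDiff (𝓡 d) 𝓘(ℝ, ℝ) 2 g := hC2.pow 2
  obtain ⟨u₀, hu₀⟩ := exists_norm_eq (EuclideanSpace ℝ (Fin (d + 1))) zero_le_one
  have hconst := fun v => eq_of_hasSphericalGradientAt_zero hrank hgrad v ⟨u₀, by simpa using hu₀⟩
  generalize sphericalLaplacian g ⟨u₀, _⟩ + _ = c at hconst
  -- Chosen so that k‖x‖² has Laplacian c on ℝ^(d+1).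
  set k : ℝ := c / (2 * (d + 1)) with hk
  have hmul : ∀ x : EuclideanSpace ℝ (Fin (d + 1)), ContDiffAt ℝ 2 (fun x => ‖x‖ ^ 2) x :=
    fun x => (contDiff_norm_sq ℝ).contDiffAt
  obtain ⟨B, hB⟩ := exists_bilin_of_homogeneous_harmonic
    (f := fun x => ‖x‖ ^ 2 * (radialExtension g x - k))
    (fun t ht x => by
      rw [radialExtension_smul g ht, norm_smul, mul_pow, Real.norm_of_nonneg ht.le]
      ring)
    (fun x hx => (hmul x).mul ((contDiffAt_radialExtension_euclidean hg hx).sub contDiffAt_const))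
    (fun x hx => by
      have hx0 : x ≠ 0 := by
        rintro rfl
        simp at hx
      have hr := contDiffAt_radialExtension_euclidean hg hx0
      have h1 := hconst ⟨x, by simpa using hx⟩
      rw [laplacian_norm_sq_mul (fun t ht x => by rw [radialExtension_smul g ht]) hx
        (hr.sub contDiffAt_const)]
      have h2 : Laplacian.laplacian (fun x => radialExtension g x - k) x =
          Laplacian.laplacian (radialExtension g) x := by
        simp only [laplacian_eq_sum_fderiv_fderiv (stdOrthonormalBasis ℝ _)]
        rw [show fderiv ℝ (fun x => radialExtension g x - k) = fderiv ℝ (radialExtension g) from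
          funext fun y => fderiv_sub_const k]
      have h3 := radialExtension_coe g ⟨x, by simpa using hx⟩
      simp only at h3
      rw [h2, h3, finrank_euclideanSpace_fin]
      rw [sphericalLaplacian] at h1
      have h4 : c = 2 * (d + 1) * k := by
        rw [hk]
        field_simp
      push_cast
      linear_combination h1 + h4)
  obtain ⟨B', hB'⟩ := exists_bilin_add_norm_sq B k
  refine ⟨B', fun u => ?_⟩
  have := hB u
  rw [radialExtension_coe, norm_eq_of_mem_sphere] at this
  rw [hB', ← this, norm_eq_of_mem_sphere]
  ring

theorem hasSphericalGradientAt_of_sq_eq_bilin {d : ℕ}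
    {h : Metric.sphere (0 : EuclideanSpace ℝ (Fin (d + 1))) 1 → ℝ}
    (hC2 : ContMDiff (𝓡 d) 𝓘(ℝ, ℝ) 2 h)
    (B : EuclideanSpace ℝ (Fin (d + 1)) →L[ℝ] EuclideanSpace ℝ (Fin (d + 1)) →L[ℝ] ℝ)
    (hB : ∀ u : Metric.sphere (0 : EuclideanSpace ℝ (Fin (d + 1))) 1, h u ^ 2 = B u u)
    (u : Metric.sphere (0 : EuclideanSpace ℝ (Fin (d + 1))) 1) :
    HasSphericalGradientAt
      (fun v => sphericalLaplacian (fun w => h w ^ 2) v + 2 * ((d : ℝ) + 1) * h v ^ 2) 0 u := by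
  have hq : (fun x => ‖x‖ ^ 2 * radialExtension (fun w => h w ^ 2) x) = fun x => B x x := by
    funext x
    rcases eq_or_ne x 0 with rfl | hx
    · simp
    · rw [radialExtension, dif_pos hx, hB]
      simp only [map_smul, smul_apply, smul_eq_mul]
      field_simp
  have : (fun v => sphericalLaplacian (fun w => h w ^ 2) v + 2 * ((d : ℝ) + 1) * h v ^ 2) =
      fun _ => Laplacian.laplacian (fun x => B x x) 0 := by
    funext v
    rw [sphericalLaplacian_sq_add_eq hC2, hq]
    exact laplacian_bilin_const B _ _
  rw [this]
  exact hasSphericalGradientAt_const _ u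

theorem exists_bilin_supportFunction_sq_eq {d : ℕ}
    {S : Set (EuclideanSpace ℝ (Fin (d + 1)))} (hS : IsOriginCenteredEllipsoid S) :
    ∃ B : EuclideanSpace ℝ (Fin (d + 1)) →L[ℝ] EuclideanSpace ℝ (Fin (d + 1)) →L[ℝ] ℝ,
      ∀ u : Metric.sphere (0 : EuclideanSpace ℝ (Fin (d + 1))) 1,
        supportFunction S (u : EuclideanSpace ℝ (Fin (d + 1))) ^ 2 = B u u := by
  obtain ⟨l, T, hl, rfl⟩ := hS
  obtain ⟨B, hB⟩ := exists_bilin_sum_sq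
    (fun i => (EuclideanSpace.proj i : EuclideanSpace ℝ (Fin (d + 1)) →L[ℝ] ℝ).comp
      (T.symm.toContinuousLinearEquiv : EuclideanSpace ℝ (Fin (d + 1)) →L[ℝ] _))
    (fun i => l i ^ 2)
  refine ⟨B, fun u => ?_⟩
  rw [supportFunction_ellipsoid hl T (ne_zero_of_mem_unit_sphere u),
    Real.sq_sqrt (Finset.sum_nonneg fun i _ => by positivity), hB]
  simp

theorem forall_pos_or_forall_neg_of_ne_zero {X : Type*} [TopologicalSpace X] [PreconnectedSpace X]
    {h : X → ℝ} (hc : Continuous h) (hne : ∀ u, h u ≠ 0) : (∀ u, 0 < h u) ∨ ∀ u, h u < 0 := by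
  by_contra! H
  obtain ⟨⟨u, hu⟩, v, hv⟩ := H
  obtain ⟨w, hw⟩ := mem_range_of_exists_le_of_exists_ge hc ⟨u, hu⟩ ⟨v, hv⟩
  exact hne w hw

theorem mainTheorem7 (n d : ℕ) (hn : 3 ≤ n) (hd : d + 2 = n)
    (h : Metric.sphere (0 : EuclideanSpace ℝ (Fin (d + 1))) 1 → ℝ)
    (hC2 : ContMDiff (𝓡 d) 𝓘(ℝ, ℝ) 2 h)
    (hne : ∀ u, h u ≠ 0) :
    (∀ u, HasSphericalGradientAt
        (fun v => sphericalLaplacian (fun w => h w ^ 2) v + 2 * ((n : ℝ) - 1) * h v ^ 2) 0 u) ↔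
      ((∃ S : Set (EuclideanSpace ℝ (Fin (d + 1))), IsOriginCenteredEllipsoid S ∧
          ∀ u, h u = supportFunction S (u : EuclideanSpace ℝ (Fin (d + 1)))) ∨
        (∃ S : Set (EuclideanSpace ℝ (Fin (d + 1))), IsOriginCenteredEllipsoid S ∧
          ∀ u, - h u = supportFunction S (u : EuclideanSpace ℝ (Fin (d + 1))))) := by
  have hn' : (n : ℝ) - 1 = d + 1 := by
    rw [← hd]
    push_cast
    ring
  rw [hn']
  constructor
  · intro hgrad
    obtain ⟨B, hB⟩ := exists_bilin_of_sphericalGradient_eq_zero (by omega) hC2 hgrad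
    obtain ⟨l, T, hl, hT⟩ := exists_diagonalization_of_pos B fun x hx => by
      rw [← hB ⟨x, by simpa using hx⟩]
      exact sq_pos_of_ne_zero (hne _)
    have hS : IsOriginCenteredEllipsoid (T '' {x | ∑ i, x i ^ 2 / l i ^ 2 = 1}) :=
      ⟨l, T, hl, rfl⟩
    have habs : ∀ u : Metric.sphere (0 : EuclideanSpace ℝ (Fin (d + 1))) 1,
        supportFunction (T '' {x | ∑ i, x i ^ 2 / l i ^ 2 = 1})
          (u : EuclideanSpace ℝ (Fin (d + 1))) = |h u| := fun u => by
      rw [supportFunction_ellipsoid hl T (ne_zero_of_mem_unit_sphere u), ← hT, ← hB,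
        Real.sqrt_sq_eq_abs]
    have hrank : 1 < Module.rank ℝ (EuclideanSpace ℝ (Fin (d + 1))) := by
      rw [← Module.finrank_eq_rank, finrank_euclideanSpace_fin]
      exact_mod_cast (by omega : 1 < d + 1)
    -- n ≥ 3 gives d + 1 ≥ 2, so the sphere is connected and h has one sign.
    have : PreconnectedSpace (Metric.sphere (0 : EuclideanSpace ℝ (Fin (d + 1))) 1) :=
      Subtype.preconnectedSpace (isPreconnected_sphere hrank 0 1)
    rcases forall_pos_or_forall_neg_of_ne_zero hC2.continuous hne with hp | hm
    · exact Or.inl ⟨_, hS, fun u => by rw [habs, abs_of_pos (hp u)]⟩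
    · exact Or.inr ⟨_, hS, fun u => by rw [habs, abs_of_neg (hm u)]⟩
  · rintro (⟨S, hS, hSh⟩ | ⟨S, hS, hSh⟩) <;>
      obtain ⟨B, hB⟩ := exists_bilin_supportFunction_sq_eq hS <;>
      exact hasSphericalGradientAt_of_sq_eq_bilin hC2 B fun u => by
        rw [← hB, ← hSh]
        try rw [neg_sq]
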